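/- Let $M_n(x)$ $(n\ge 0)$ be the Mittag-Leffler polynomials, i.e. $$\Bigl(\frac{1+t}{1-t}\Bigr)^{x}=\sum_{n\ge 0}\frac{M_n(x)}{n!}\,t^n ,\qquad |t|<1,$$ and write $M_n(x)=\sum_{k=0}^{n}a_{n,k}x^k$. For integers $\alpha,\beta\ge 0$ put $$b_{\alpha,\beta}=\sum_{j=0}^{\beta}(-1)^j\binom{\alpha+\beta}{j}\frac{1}{2^{\beta-j}}\,a_{\alpha+\beta-j,\,\beta-j},$$ let $(s)_k=s(s-1)\cdots(s-k+1)$ denote the falling factorial, and put $z_{m,k}=\dfrac{b_{m,k}}{(m+k)!}\,(s)_k$. Then for every complex $s$ with $\Re s>0$ the following series converge absolutely and $$\zeta(s)(1-2^{1-s})\Gamma(s)=\frac{2^{s-1}}{s}\Bigl(\frac1{s+1}+\sum_{m=1}^{\infty}\frac{1}{s+m+1}\sum_{k=1}^{\lfloor m/2\rfloor}\frac{b_{m,k}}{(m+k)!}(s)_k\Bigr)$$ $$=\frac{2^{s-1}}{s}\Bigl(\frac1{s+1}+\sum_{m=1}^{\infty}\frac{1}{s+2m+1}\sum_{k=1}^{m}\frac{b_{2m,k}}{(2m+k)!}(s)_k\Bigr)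 =\frac{2^{s-1}}{s}\Bigl(\frac1{s+1}+\sum_{m=1}^{\infty}\frac{1}{s+2m+1}\sum_{k=1}^{m}z_{2m,k}\Bigr).$$ At $s=1$, where $\zeta$ has a pole and $1-2^{1-s}$ a zero, the left-hand side is understood as its limit, which is $\log 2$; with this value it is continuous on $\Re s>0$. Moreover, for all integers $m\ge 2$ and $k\ge 1$, $$z_{m,k}=\frac{m+k-2}{m+k}\,z_{m-2,k}+\frac{s-k+1}{m+k}\,z_{m-2,k-1}.$$ -/

import Mathlib

open Polynomial in
/-- The Mittag-Leffler polynomial `M_n(x) = n! [t^n] ((1 + t) / (1 - t)) ^ x`: the power series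
`(1 + t) ^ x * (1 - t) ^ (-x)` in `t` is formed over the polynomial ring `ℚ[x]`
(the second factor is `(1 + t) ^ (-x)` with `t` replaced by `-t`). -/
noncomputable def mittagLeffler (n : ℕ) : ℚ[X] :=
  (n.factorial : ℚ) • PowerSeries.coeff n
    (PowerSeries.binomialSeries ℚ[X] (X : ℚ[X]) *
      PowerSeries.evalNegHom (PowerSeries.binomialSeries ℚ[X] (-X : ℚ[X])))

/-- The generating function of the Mittag-Leffler polynomials. -/
theorem hasSum_mittagLeffler (x t : ℂ) (ht : ‖t‖ < 1) :
    HasSum (fun n : ℕ => (Polynomial.aeval x (mittagLeffler n)) / (n.factorial : ℂ) * t ^ n)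
      (((1 + t) / (1 - t)) ^ x) := by
  have key : ∀ (y u : ℂ), ‖u‖ < 1 →
      Summable (fun n : ℕ => ‖Ring.choose y n * u ^ n‖) ∧
        HasSum (fun n : ℕ => Ring.choose y n * u ^ n) ((1 + u) ^ y) := by
    intro y u hu
    have h := Complex.one_add_cpow_hasFPowerSeriesOnBall_zero (a := y)
    have hu' : u ∈ Metric.eball (0 : ℂ) 1 := by
      rw [← ENNReal.ofReal_one, Metric.eball_ofReal]
      simpa using hu
    have h1 := h.hasSum hu'
    have h2 := (binomialSeries ℂ y).summable_norm_apply
      (Metric.eball_subset_eball h.r_le hu')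
    constructor
    · simpa [binomialSeries, mul_comm] using h2
    · simpa [binomialSeries, mul_comm] using h1
  obtain ⟨s1, h1⟩ := key x t ht
  obtain ⟨s2, h2⟩ := key (-x) (-t) (by simpa using ht)
  have hp := (summable_norm_sum_mul_antidiagonal_of_summable_norm s1 s2).of_norm.hasSum
  rw [← tsum_mul_tsum_eq_tsum_sum_antidiagonal_of_summable_norm s1 s2, h1.tsum_eq,
    h2.tsum_eq] at hp
  have hval : (1 + t) ^ x * (1 + -t) ^ (-x) = ((1 + t) / (1 - t)) ^ x := by
    have hre := (abs_le.1 (Complex.abs_re_le_norm t))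
    have p1 : 0 < (1 + t).re := by simp; linarith
    have p2 : 0 < (1 - t).re := by simp; linarith
    have n1 : 1 + t ≠ 0 := fun h => by simp [h] at p1
    have n2 : 1 - t ≠ 0 := fun h => by simp [h] at p2
    have a1 := abs_lt.1 (Complex.abs_arg_lt_pi_div_two_iff.2 (Or.inl p1))
    have a2 := abs_lt.1 (Complex.abs_arg_lt_pi_div_two_iff.2 (Or.inl p2))
    have hinv : (1 - t)⁻¹.arg = -(1 - t).arg := by
      rw [Complex.arg_inv, if_neg]
      intro h
      linarith [Real.pi_pos]
    have hlog : Complex.log ((1 + t) * (1 - t)⁻¹) = Complex.log (1 + t) - Complex.log (1 - t) := by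
      rw [(Complex.log_mul_eq_add_log_iff n1 (inv_ne_zero n2)).2
        (by rw [hinv]; constructor <;> linarith [Real.pi_pos]),
        Complex.log_inv _ (by intro h; linarith [Real.pi_pos]), ← sub_eq_add_neg]
    rw [div_eq_mul_inv, ← sub_eq_add_neg, Complex.cpow_def_of_ne_zero n1,
      Complex.cpow_def_of_ne_zero n2,
      Complex.cpow_def_of_ne_zero (mul_ne_zero n1 (inv_ne_zero n2)), hlog, ← Complex.exp_add]
    ring_nf
  rw [hval] at hp
  refine Eq.mpr (congrArg (fun f => HasSum f _) (funext fun n => ?_)) hp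
  have hn : (n.factorial : ℂ) ≠ 0 := by exact_mod_cast n.factorial_ne_zero
  have hc : Polynomial.aeval x (mittagLeffler n) = (n.factorial : ℂ) *
      ∑ p ∈ Finset.HasAntidiagonal.antidiagonal n, Ring.choose x p.1 * ((-1) ^ p.2 * Ring.choose (-x) p.2) := by
    simp [mittagLeffler, PowerSeries.coeff_mul, PowerSeries.evalNegHom, PowerSeries.coeff_rescale,
      Ring.map_choose, Algebra.smul_def]
  rw [hc, mul_div_cancel_left₀ _ hn, Finset.sum_mul]
  refine Finset.sum_congr rfl fun p hpn => ?_
  rw [← Finset.HasAntidiagonal.mem_antidiagonal.1 hpn, pow_add, neg_pow t]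
  ring

/-- The number `a_{n,k}`: the coefficient of `x ^ k` in `M_n(x)`. -/
noncomputable def mittagLefflerCoeff (n k : ℕ) : ℚ := (mittagLeffler n).coeff k

/-- The number
`b_{α,β} = ∑_{j=0}^{β} (-1)^j binom(α+β, j) 2^{-(β-j)} a_{α+β-j, β-j}`. -/
noncomputable def bCoeff (α β : ℕ) : ℚ :=
  ∑ j ∈ Finset.range (β + 1),
    (-1) ^ j * ((α + β).choose j : ℚ) * (1 / 2 ^ (β - j)) *
      mittagLefflerCoeff (α + β - j) (β - j)

/-- The number `z_{m,k} = b_{m,k} / (m+k)! * (s)_k`, with `(s)_k = s (s-1) ⋯ (s-k+1)` the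
falling factorial. -/
noncomputable def zCoeff (s : ℂ) (m k : ℕ) : ℂ :=
  (bCoeff m k : ℂ) / ((m + k).factorial : ℂ) * (descPochhammer ℂ k).eval s

/-- The function `ζ(s) (1 - 2^{1-s}) Γ(s)`, with its limit `log 2` as the value at the removable
singularity `s = 1`. -/
noncomputable def zetaGammaProduct (s : ℂ) : ℂ :=
  if s = 1 then (Real.log 2 : ℂ)
  else riemannZeta s * (1 - 2 ^ (1 - s)) * Complex.Gamma s

/-! The Mellin transform of `e^x / (e^x + 1)^2` at `s + 1` equals `s ζ(s) (1 - 2^{1-s}) Γ(s)`: this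
follows by expanding in powers of `e^{-x}` for `Re s > 1`, then by analytic continuation
(`mellin_logisticDensity`). The substitution `t = tanh (x/2)`, for which `x = 2 artanh t` and `dt`
is twice the density, turns it into `2^{s-1}/s ∫_0^1 (artanh t)^s dt`
(`zetaGammaProduct_eq_integral`).

Put `F(y) = ∑ y^n/(2n+1)`, so that `artanh t = t F(t^2)`. Expanding `F^s = (1 + (F - 1))^s`
binomially and integrating `t^{s+2m}` gives the series. Its coefficients are the stated ones because
the coefficient of `x^k` in `((1+t)/(1-t))^x` is `(2 artanh t)^k / k!`, whence `b_{α,β}/(α+β)!` is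
the coefficient of `t^{α+β}` in `(artanh t - t)^β / β!` (`bCoeff_eq_coeff`). Parity and the
recurrence are read off from this power.

The delicate point is termwise integration, since `F - 1` exceeds 1 near `y = 1`. Instead `F^s` is
written as `(1 - g)^{-s}` with `g = 1 - 1/F`. By Kaluza's lemma `g` has nonnegative coefficients, so
the coefficients of `F^s` are dominated by those of `F^N` for any integer `N ≥ |s|`
(`norm_artanhQuotCpowCoeff_le`), and integrability of `artanh^N` gives absolute convergence. -/

/-! ### Differential equation of the Mittag-Leffler generating function -/

open PowerSeries in
theorem one_add_X_mul_derivative_binomialSeries {R : Type*} [CommRing R] [BinomialRing R] (r : R) :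
    (1 + X) * d⁄dX R (binomialSeries R r) = C r * binomialSeries R r := by
  have key : ∀ n : ℕ, Ring.choose r (n + 1) * (n + 1) = (r - n) * Ring.choose r n := by
    intro n
    have h := Ring.choose_smul_choose r (Nat.le_succ n)
    simp only [Nat.succ_eq_add_one, Nat.choose_succ_self_right, nsmul_eq_mul, Nat.cast_add,
      Nat.cast_one, add_tsub_cancel_left, Ring.choose_one_right] at h
    rw [mul_comm, h, mul_comm]
  ext n
  rw [add_mul, one_mul, map_add, coeff_C_mul, coeff_derivative]
  rcases n with _ | n
  · have := key 0
    simp at this ⊢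
  · rw [coeff_succ_X_mul, coeff_derivative]
    simp only [binomialSeries_coeff, smul_eq_mul, mul_one]
    have h1 := key (n + 1)
    rw [h1]
    push_cast
    ring

open PowerSeries in
theorem derivative_evalNegHom {R : Type*} [CommRing R] (f : PowerSeries R) :
    d⁄dX R (evalNegHom f) = -evalNegHom (d⁄dX R f) := by
  ext n
  simp only [evalNegHom, coeff_derivative, coeff_rescale, map_neg, pow_succ]
  ring

-- The logarithmic derivative of `((1 + t)/(1 - t))^r` is `2r/(1 - t^2)`.
open PowerSeries in
theorem one_sub_X_sq_mul_derivative_binomialSeries_mul {R : Type*} [CommRing R] [BinomialRing R]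
    (r : R) :
    (1 - X ^ 2) * d⁄dX R (binomialSeries R r * evalNegHom (binomialSeries R (-r))) =
      C (2 * r) * (binomialSeries R r * evalNegHom (binomialSeries R (-r))) := by
  have h1 := one_add_X_mul_derivative_binomialSeries r
  have h2 := congrArg evalNegHom (one_add_X_mul_derivative_binomialSeries (-r))
  have hC : ∀ r : R, evalNegHom (C r) = C r := by
    intro r
    ext n
    rw [evalNegHom, coeff_rescale, coeff_C]
    split_ifs with h <;> simp [h]
  simp only [map_mul, map_add, map_one, evalNegHom_X, hC] at h2
  rw [Derivation.leibniz, smul_eq_mul, smul_eq_mul, derivative_evalNegHom]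
  simp only [map_mul, map_neg, map_ofNat] at h2 ⊢
  linear_combination (1 - X) * evalNegHom (binomialSeries R (-r)) * h1 -
    (1 + X) * binomialSeries R r * h2

open PowerSeries in
theorem coeff_one_sub_X_sq_mul {R : Type*} [CommRing R] (f : PowerSeries R) (n : ℕ) :
    coeff n ((1 - X ^ 2) * f) = coeff n f - if 2 ≤ n then coeff (n - 2) f else 0 := by
  rw [sub_mul, one_mul, map_sub, coeff_X_pow_mul']

open PowerSeries in
theorem coeff_succ_binomialSeries_mul {R : Type*} [CommRing R] [BinomialRing R] (r : R) (n : ℕ) :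
    coeff (n + 1) (binomialSeries R r * evalNegHom (binomialSeries R (-r))) * (n + 1 : ℕ) -
      (if 2 ≤ n then coeff (n - 2 + 1) (binomialSeries R r * evalNegHom (binomialSeries R (-r))) *
        (n - 2 + 1 : ℕ) else 0) =
      2 * r * coeff n (binomialSeries R r * evalNegHom (binomialSeries R (-r))) := by
  have h := congrArg (coeff n) (one_sub_X_sq_mul_derivative_binomialSeries_mul r)
  rw [coeff_one_sub_X_sq_mul, coeff_C_mul, coeff_derivative, coeff_derivative] at h
  simpa using h

/-- The generating function `((1 + t) / (1 - t)) ^ x` over `ℚ[x]`. -/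
noncomputable def mittagLefflerSeries : PowerSeries (Polynomial ℚ) :=
  PowerSeries.binomialSeries (Polynomial ℚ) (Polynomial.X : Polynomial ℚ) *
    PowerSeries.evalNegHom (PowerSeries.binomialSeries (Polynomial ℚ) (-Polynomial.X : Polynomial ℚ))

/-- The coefficient of `x ^ k` in the generating function of the Mittag-Leffler polynomials. -/
noncomputable def mittagLefflerColumn (k : ℕ) : PowerSeries ℚ :=
  PowerSeries.mk fun n => (PowerSeries.coeff n mittagLefflerSeries).coeff k

theorem mittagLefflerCoeff_eq (n k : ℕ) :
    mittagLefflerCoeff n k = n.factorial * PowerSeries.coeff n (mittagLefflerColumn k) := by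
  simp [mittagLefflerCoeff, mittagLeffler, mittagLefflerColumn, mittagLefflerSeries]

open PowerSeries in
theorem coeff_derivative_mittagLefflerColumn (k n : ℕ) :
    coeff n ((1 - X ^ 2) * d⁄dX ℚ (mittagLefflerColumn k)) =
      (2 * Polynomial.X * coeff n mittagLefflerSeries).coeff k := by
  have h := congrArg (fun p => Polynomial.coeff p k)
    (coeff_succ_binomialSeries_mul (Polynomial.X : Polynomial ℚ) n)
  rw [coeff_one_sub_X_sq_mul, coeff_derivative, coeff_derivative, mittagLefflerColumn, coeff_mk,
    coeff_mk, ← Nat.cast_succ, ← Nat.cast_succ]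
  refine Eq.trans ?_ h
  simp only [Polynomial.coeff_sub, Polynomial.coeff_mul_natCast]
  congr 1
  split_ifs
  · rw [Polynomial.coeff_mul_natCast]
    rfl
  · simp

open PowerSeries in
theorem derivative_mittagLefflerColumn_zero : d⁄dX ℚ (mittagLefflerColumn 0) = 0 := by
  have h : (1 - X ^ 2) * d⁄dX ℚ (mittagLefflerColumn 0) = 0 := by
    ext n
    rw [coeff_derivative_mittagLefflerColumn]
    simp [Polynomial.mul_coeff_zero]
  refine (mul_eq_zero.1 h).resolve_left fun h0 => ?_
  simpa using congrArg constantCoeff h0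

open PowerSeries in
theorem derivative_mittagLefflerColumn_succ (k : ℕ) :
    (1 - X ^ 2) * d⁄dX ℚ (mittagLefflerColumn (k + 1)) = 2 * mittagLefflerColumn k := by
  ext n
  rw [coeff_derivative_mittagLefflerColumn, mul_assoc, ← map_ofNat (C (R := ℚ)) 2, coeff_C_mul,
    ← map_ofNat (Polynomial.C (R := ℚ)) 2, Polynomial.coeff_C_mul, Polynomial.coeff_X_mul,
    mittagLefflerColumn, coeff_mk]

theorem constantCoeff_mittagLefflerColumn (k : ℕ) :
    PowerSeries.constantCoeff (mittagLefflerColumn k) = if k = 0 then 1 else 0 := by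
  rw [← PowerSeries.coeff_zero_eq_constantCoeff_apply, mittagLefflerColumn, PowerSeries.coeff_mk,
    mittagLefflerSeries, PowerSeries.coeff_zero_eq_constantCoeff_apply]
  simp [PowerSeries.evalNegHom, ← PowerSeries.coeff_zero_eq_constantCoeff_apply,
    PowerSeries.coeff_rescale, -PowerSeries.coeff_zero_eq_constantCoeff, Polynomial.coeff_one,
    PowerSeries.coeff_mul]

/-! ### Powers of artanh and the numbers `b_{α,β}` -/

/-- The power series `∑ y ^ n / (2 n + 1)`, that is `artanh t / t` with `y = t ^ 2`. -/
noncomputable def artanhQuotSeries : PowerSeries ℚ := PowerSeries.mk fun n => 1 / (2 * n + 1)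

/-- The power series of `artanh`. -/
noncomputable def artanhSeries : PowerSeries ℚ :=
  PowerSeries.X * PowerSeries.expand 2 two_ne_zero artanhQuotSeries

theorem constantCoeff_artanhSeries : PowerSeries.constantCoeff artanhSeries = 0 := by
  simp [artanhSeries]

open PowerSeries in
theorem one_sub_X_sq_mul_derivative_artanhSeries :
    (1 - X ^ 2) * d⁄dX ℚ artanhSeries = 1 := by
  have hc : ∀ n, coeff n (d⁄dX ℚ artanhSeries) = if 2 ∣ n then 1 else 0 := by
    intro n
    rw [coeff_derivative, artanhSeries, coeff_succ_X_mul, coeff_expand]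
    split_ifs with h
    · obtain ⟨m, rfl⟩ := h
      rw [Nat.mul_div_cancel_left _ two_pos, artanhQuotSeries, coeff_mk]
      push_cast
      field_simp
    · simp
  ext n
  rw [coeff_one_sub_X_sq_mul, hc, hc, coeff_one]
  rcases n with _ | _ | n
  · simp
  · simp
  · simp

-- Induction on `k`: both sides have the same constant term, and the same derivative because `(1 -
-- t^2) artanh' = 1`.
open PowerSeries in
theorem mittagLefflerColumn_eq (k : ℕ) :
    mittagLefflerColumn k = C (2 ^ k / k.factorial : ℚ) * artanhSeries ^ k := by
  have hne : (1 - X ^ 2 : PowerSeries ℚ) ≠ 0 := fun h0 => by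
    simpa using congrArg constantCoeff h0
  induction k with
  | zero =>
    refine derivative.ext ?_ ?_
    · rw [derivative_mittagLefflerColumn_zero]
      simp
    · simp [constantCoeff_mittagLefflerColumn]
  | succ k ih =>
    refine derivative.ext (mul_left_cancel₀ hne ?_) ?_
    · rw [derivative_mittagLefflerColumn_succ, ih, Derivation.leibniz, derivative_C, smul_zero,
        add_zero, derivative_pow, smul_eq_mul]
      have hk : (2 ^ (k + 1) / (k + 1).factorial : ℚ) * (k + 1 : ℕ) = 2 * (2 ^ k / k.factorial) := by
        rw [Nat.factorial_succ]
        push_cast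
        have : (k.factorial : ℚ) ≠ 0 := by positivity
        field_simp
        ring
      have hk' := congrArg (C (R := ℚ)) hk
      simp only [map_mul, map_natCast, map_ofNat] at hk'
      simp only [Nat.add_sub_cancel]
      linear_combination -artanhSeries ^ k * hk' - C (2 ^ (k + 1) / (k + 1).factorial : ℚ) *
        (k + 1 : ℕ) * artanhSeries ^ k * one_sub_X_sq_mul_derivative_artanhSeries
    · simp [constantCoeff_mittagLefflerColumn, constantCoeff_artanhSeries]

-- Binomial theorem for `(artanh t - t)^b`: the factor `t^j` shifts the coefficient index to `a + b
-- - j`, and the `2^{b-j}` of the column cancels the `1/2^{b-j}` in the definition of `b`.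
open PowerSeries in
theorem bCoeff_eq_coeff (a b : ℕ) :
    bCoeff a b / (a + b).factorial =
      coeff (a + b) ((artanhSeries - X) ^ b) / b.factorial := by
  have hexp : (artanhSeries - X : PowerSeries ℚ) ^ b =
      ∑ j ∈ Finset.range (b + 1), C ((-1) ^ j * (b.choose j : ℚ)) *
        (X ^ j * artanhSeries ^ (b - j)) := by
    rw [sub_eq_neg_add, add_pow]
    refine Finset.sum_congr rfl fun j _ => ?_
    rw [neg_pow X]
    simp
    ring
  rw [hexp, map_sum, bCoeff, Finset.sum_div, Finset.sum_div]
  refine Finset.sum_congr rfl fun j hj => ?_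
  have hjb : j ≤ b := Nat.lt_succ_iff.1 (Finset.mem_range.1 hj)
  rw [coeff_C_mul, coeff_X_pow_mul', if_pos (by omega), mittagLefflerCoeff_eq,
    mittagLefflerColumn_eq, coeff_C_mul, Nat.cast_choose ℚ hjb,
    Nat.cast_choose ℚ (by omega : j ≤ a + b)]
  have h1 : ((a + b).factorial : ℚ) ≠ 0 := by positivity
  have h2 : (b.factorial : ℚ) ≠ 0 := by positivity
  have h3 : (j.factorial : ℚ) ≠ 0 := by positivity
  have h4 : ((b - j).factorial : ℚ) ≠ 0 := by positivity
  have h5 : ((a + b - j).factorial : ℚ) ≠ 0 := by positivity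
  field_simp

-- Since `artanh t - t = t (F(t^2) - 1)`, its `b`-th power is `t^b` times an even series; hence the
-- numbers with odd first index vanish.
open PowerSeries in
theorem bCoeff_eq_coeff_expand (a b : ℕ) :
    bCoeff a b / (a + b).factorial =
      coeff a (expand 2 two_ne_zero ((artanhQuotSeries - 1) ^ b)) / b.factorial := by
  rw [bCoeff_eq_coeff, artanhSeries,
    show X * expand 2 two_ne_zero artanhQuotSeries - X =
      X * expand 2 two_ne_zero (artanhQuotSeries - 1) by rw [map_sub, map_one]; ring,
    mul_pow, ← map_pow, add_comm a b, coeff_X_pow_mul', if_pos (by omega), Nat.add_sub_cancel_left]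

theorem bCoeff_even (m k : ℕ) :
    bCoeff (2 * m) k / (2 * m + k).factorial =
      PowerSeries.coeff m ((artanhQuotSeries - 1) ^ k) / k.factorial := by
  rw [bCoeff_eq_coeff_expand, PowerSeries.coeff_expand_mul]

theorem bCoeff_odd (m k : ℕ) : bCoeff (2 * m + 1) k / (2 * m + 1 + k).factorial = 0 := by
  rw [bCoeff_eq_coeff_expand, PowerSeries.coeff_expand_of_not_dvd _ _ _ (by omega), zero_div]

-- From `(1 - t^2)(artanh' - 1) = t^2`, differentiating `(artanh t - t)^{k+1}` gives `(k+1) t^2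
-- (artanh t - t)^k / (1 - t^2)`; compare coefficients of `t^{m+k+2}`.
open PowerSeries in
theorem bCoeff_recurrence (m k : ℕ) :
    ((m + 2 + (k + 1) : ℕ) : ℚ) * (bCoeff (m + 2) (k + 1) / (m + 2 + (k + 1)).factorial) =
      (m + (k + 1) : ℕ) * (bCoeff m (k + 1) / (m + (k + 1)).factorial) +
        bCoeff m k / (m + k).factorial := by
  have hd : (1 - X ^ 2) * d⁄dX ℚ ((artanhSeries - X) ^ (k + 1)) =
      X ^ 2 * (C ((k + 1 : ℕ) : ℚ) * (artanhSeries - X) ^ k) := by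
    rw [derivative_pow, map_sub, derivative_X, map_natCast, Nat.add_sub_cancel]
    linear_combination ((k + 1 : ℕ) : PowerSeries ℚ) * (artanhSeries - X) ^ k *
      one_sub_X_sq_mul_derivative_artanhSeries
  have h := congrArg (coeff (m + k + 2)) hd
  rw [coeff_one_sub_X_sq_mul, if_pos (by omega), coeff_X_pow_mul', if_pos (by omega),
    coeff_derivative, coeff_derivative, coeff_C_mul,
    show m + k + 2 - 2 = m + k by omega, show m + k + 2 + 1 = m + 2 + (k + 1) by ring,
    show m + k + 1 = m + (k + 1) by ring] at h
  rw [bCoeff_eq_coeff, bCoeff_eq_coeff, bCoeff_eq_coeff, Nat.factorial_succ]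
  have h1 : (k.factorial : ℚ) ≠ 0 := by positivity
  push_cast at h ⊢
  field_simp
  linear_combination h

theorem zCoeff_recurrence (s : ℂ) (m k : ℕ) (hm : 2 ≤ m) (hk : 1 ≤ k) :
    zCoeff s m k = ((m : ℂ) + k - 2) / (m + k) * zCoeff s (m - 2) k +
      (s - k + 1) / (m + k) * zCoeff s (m - 2) (k - 1) := by
  obtain ⟨m, rfl⟩ := Nat.exists_eq_add_of_le' hm
  obtain ⟨k, rfl⟩ := Nat.exists_eq_add_of_le' hk
  have h := congrArg (fun q : ℚ => (q : ℂ)) (bCoeff_recurrence m k)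
  simp only [Nat.add_sub_cancel, zCoeff, descPochhammer_succ_right, Polynomial.eval_mul,
    Polynomial.eval_sub, Polynomial.eval_X, Polynomial.eval_natCast]
  push_cast at h ⊢
  have h0 : (m + 2 + (k + 1) : ℂ) ≠ 0 := by exact_mod_cast (by omega : m + 2 + (k + 1) ≠ 0)
  rw [div_mul_eq_mul_div _ _ (bCoeff m (k + 1) / _ * _ : ℂ),
    div_mul_eq_mul_div _ _ (bCoeff m k / _ * _ : ℂ), ← add_div, eq_div_iff h0]
  linear_combination (descPochhammer ℂ k).eval s * (s - k) * h

/-! ### Formal powers with arbitrary exponent -/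

theorem Ring.choose_eq_eval_descPochhammer_div {K : Type*} [Field K] [CharZero K] (s : K) (k : ℕ) :
    Ring.choose s k = (descPochhammer K k).eval s / k.factorial := by
  rw [Ring.choose_eq_smul, ← descPochhammer_map (Int.castRingHom K), Polynomial.eval_map,
    ← Polynomial.eval₂_smulOneHom_eq_smeval, smul_eq_mul, div_eq_inv_mul]
  congr 2
  exact Subsingleton.elim _ _

theorem Ring.multichoose_eq_eval_ascPochhammer_div {K : Type*} [Field K] [CharZero K] (s : K)
    (k : ℕ) : Ring.multichoose s k = (ascPochhammer K k).eval s / k.factorial := by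
  have h := Ring.factorial_nsmul_multichoose_eq_ascPochhammer s k
  rw [nsmul_eq_mul] at h
  rw [eq_div_iff (by exact_mod_cast k.factorial_ne_zero), mul_comm, h,
    ← ascPochhammer_map (Nat.castRingHom K), Polynomial.eval_map,
    ← Polynomial.eval₂_smulOneHom_eq_smeval]
  congr 1
  exact Subsingleton.elim _ _

theorem PowerSeries.coeff_pow_eq_zero_of_constantCoeff {R : Type*} [CommRing R] {w : PowerSeries R}
    (hw : PowerSeries.constantCoeff w = 0) {m k : ℕ} (h : m < k) :
    PowerSeries.coeff m (w ^ k) = 0 :=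
  PowerSeries.X_pow_dvd_iff.1 (pow_dvd_pow_of_dvd (PowerSeries.X_dvd_iff.2 hw) k) m h

theorem PowerSeries.sum_choose_mul_coeff_pow {K : Type*} [Field K] [CharZero K]
    {w : PowerSeries K} (hw : PowerSeries.constantCoeff w = 0) (N m : ℕ) :
    ∑ k ∈ Finset.range (m + 1), Ring.choose (N : K) k * PowerSeries.coeff m (w ^ k) =
      PowerSeries.coeff m ((1 + w) ^ N) := by
  have h1 : ∀ M, m ≤ M →
      ∑ k ∈ Finset.range (m + 1), Ring.choose (N : K) k * PowerSeries.coeff m (w ^ k) =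
      ∑ k ∈ Finset.range (M + 1), Ring.choose (N : K) k * PowerSeries.coeff m (w ^ k) := by
    intro M hM
    refine Finset.sum_subset (Finset.range_mono (by omega)) fun k _ hk => ?_
    rw [PowerSeries.coeff_pow_eq_zero_of_constantCoeff hw
      (by simpa using hk), mul_zero]
  -- `m + N` bounds both cutoffs: terms with `k > m` vanish by order in `X`, those with `k > N`
  -- because the binomial coefficient is zero.
  rw [h1 (m + N) (by omega), add_comm 1 w, add_pow, map_sum]
  symm
  refine (Finset.sum_congr rfl fun k _ => ?_).trans (Finset.sum_subset
    (Finset.range_mono (by omega : N + 1 ≤ m + N + 1)) fun k _ hk => ?_)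
  · rw [one_pow, mul_one, ← map_natCast (PowerSeries.C (R := K)), PowerSeries.coeff_mul_C,
      Ring.choose_natCast, mul_comm]
  · rw [Ring.choose_natCast, Nat.choose_eq_zero_of_lt (by simpa using hk), Nat.cast_zero, zero_mul]

/-- Truncated form of `(1 - g) (1 - g)^{-(N+1)} = (1 - g)^{-N}`, by Pascal's rule for
`Ring.multichoose`. -/
theorem one_sub_mul_sum_multichoose {K : Type*} [Field K] [CharZero K] (g : PowerSeries K)
    (N M : ℕ) :
    (1 - g) * ∑ j ∈ Finset.range (M + 1), PowerSeries.C (Ring.multichoose ((N + 1 : ℕ) : K) j) *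
        g ^ j =
      ∑ j ∈ Finset.range (M + 1), PowerSeries.C (Ring.multichoose (N : K) j) * g ^ j -
        PowerSeries.C (Ring.multichoose ((N + 1 : ℕ) : K) M) * g ^ (M + 1) := by
  induction M with
  | zero => simp
  | succ M ih =>
    rw [Finset.sum_range_succ, mul_add, ih, Finset.sum_range_succ _ (M + 1)]
    have h := congrArg (PowerSeries.C (R := K)) (Ring.multichoose_succ_succ (N : K) M)
    rw [map_add] at h
    push_cast at h ⊢
    linear_combination g ^ (M + 1) * h

theorem PowerSeries.sum_multichoose_mul_coeff_pow {K : Type*} [Field K] [CharZero K]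
    {f g : PowerSeries K} (hg : PowerSeries.constantCoeff g = 0) (hfg : f * (1 - g) = 1)
    (N m : ℕ) :
    ∑ j ∈ Finset.range (m + 1), Ring.multichoose (N : K) j * PowerSeries.coeff m (g ^ j) =
      PowerSeries.coeff m (f ^ N) := by
  have key : PowerSeries.X ^ (m + 1) ∣ (∑ j ∈ Finset.range (m + 1),
      PowerSeries.C (Ring.multichoose (N : K) j) * g ^ j) - f ^ N := by
    induction N with
    | zero =>
      have : ∑ j ∈ Finset.range (m + 1), PowerSeries.C (Ring.multichoose ((0 : ℕ) : K) j) * g ^ j =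
          1 := by
        rw [Finset.sum_range_succ']
        simp [Ring.multichoose_zero_succ]
      rw [this]
      simp
    | succ N ih =>
      have h2 : PowerSeries.X ^ (m + 1) ∣
          PowerSeries.C (Ring.multichoose ((N + 1 : ℕ) : K) m) * g ^ (m + 1) :=
        (pow_dvd_pow_of_dvd (PowerSeries.X_dvd_iff.2 hg) _).mul_left _
      have h3 := (dvd_sub ih h2).mul_left f
      convert h3 using 1
      linear_combination f * one_sub_mul_sum_multichoose g N m -
        (∑ j ∈ Finset.range (m + 1), PowerSeries.C (Ring.multichoose ((N + 1 : ℕ) : K) j) * g ^ j) *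
          hfg
  have h := PowerSeries.X_pow_dvd_iff.1 key m (Nat.lt_succ_self m)
  rw [map_sub, sub_eq_zero, map_sum] at h
  rw [← h]
  simp

/-- The coefficients of `(1 + w) ^ s = (1 - g) ^ (-s)` computed from both sides. -/
theorem PowerSeries.sum_choose_eq_sum_multichoose {K : Type*} [Field K] [CharZero K]
    {w g : PowerSeries K} (hw : PowerSeries.constantCoeff w = 0)
    (hg : PowerSeries.constantCoeff g = 0) (hwg : (1 + w) * (1 - g) = 1) (s : K) (m : ℕ) :
    ∑ k ∈ Finset.range (m + 1), Ring.choose s k * PowerSeries.coeff m (w ^ k) =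
      ∑ j ∈ Finset.range (m + 1), Ring.multichoose s j * PowerSeries.coeff m (g ^ j) := by
  let P : Polynomial K := ∑ k ∈ Finset.range (m + 1),
    Polynomial.C (PowerSeries.coeff m (w ^ k) / k.factorial) * descPochhammer K k
  let Q : Polynomial K := ∑ k ∈ Finset.range (m + 1),
    Polynomial.C (PowerSeries.coeff m (g ^ k) / k.factorial) * ascPochhammer K k
  have hP : ∀ s, P.eval s =
      ∑ k ∈ Finset.range (m + 1), Ring.choose s k * PowerSeries.coeff m (w ^ k) := by
    intro s
    simp only [P, Polynomial.eval_finsetSum, Polynomial.eval_mul, Polynomial.eval_C,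
      Ring.choose_eq_eval_descPochhammer_div]
    exact Finset.sum_congr rfl fun k _ => by ring
  have hQ : ∀ s, Q.eval s =
      ∑ k ∈ Finset.range (m + 1), Ring.multichoose s k * PowerSeries.coeff m (g ^ k) := by
    intro s
    simp only [Q, Polynomial.eval_finsetSum, Polynomial.eval_mul, Polynomial.eval_C,
      Ring.multichoose_eq_eval_ascPochhammer_div]
    exact Finset.sum_congr rfl fun k _ => by ring
  -- Both sides are polynomials in `s`, so agreement at all natural numbers suffices; there each is
  -- a coefficient of the ordinary power `(1 + w)^N`.
  have hPQ : P = Q := by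
    refine Polynomial.eq_of_infinite_eval_eq P Q
      ((Set.infinite_range_of_injective Nat.cast_injective).mono ?_)
    rintro _ ⟨N, rfl⟩
    simp only [Set.mem_ofPred_eq]
    rw [hP, hQ, PowerSeries.sum_choose_mul_coeff_pow hw,
      PowerSeries.sum_multichoose_mul_coeff_pow hg hwg]
  rw [← hP, ← hQ, hPQ]

/-! ### Positivity and domination of coefficients -/

theorem norm_multichoose_le (s : ℂ) (N : ℕ) (hs : ‖s‖ ≤ N) (j : ℕ) :
    ‖Ring.multichoose s j‖ ≤ Ring.multichoose (N : ℝ) j := by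
  rw [Ring.multichoose_eq_eval_ascPochhammer_div, Ring.multichoose_eq_eval_ascPochhammer_div,
    norm_div, Complex.norm_natCast]
  gcongr
  induction j with
  | zero => simp
  | succ j ih =>
    rw [ascPochhammer_succ_eval, ascPochhammer_succ_eval, norm_mul]
    refine mul_le_mul ih ((norm_add_le _ _).trans ?_) (norm_nonneg _) ((norm_nonneg _).trans ih)
    rw [Complex.norm_natCast]
    gcongr

open Finset.HasAntidiagonal in
/-- Kaluza's lemma: if `a` has nondecreasing ratios, then `1 - 1 / ∑ a n X ^ n` has nonnegative
coefficients. -/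
theorem kaluza {a : ℕ → ℝ} (h0 : a 0 = 1) (hpos : ∀ n, 0 < a n)
    (hlog : ∀ i n, i ≤ n → a (i + 1) * a n ≤ a i * a (n + 1)) {g : PowerSeries ℝ}
    (hg0 : PowerSeries.constantCoeff g = 0) (hg : PowerSeries.mk a * (1 - g) = 1) (n : ℕ) :
    0 ≤ PowerSeries.coeff n g := by
  have hconv : ∀ n, ∑ p ∈ antidiagonal (n + 1), a p.1 * PowerSeries.coeff p.2 g =
      a (n + 1) := by
    intro n
    have h := congrArg (PowerSeries.coeff (n + 1)) hg
    rw [mul_sub, mul_one, map_sub, PowerSeries.coeff_mul, PowerSeries.coeff_one,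
      if_neg n.succ_ne_zero, sub_eq_zero] at h
    simpa using h.symm
  induction n using Nat.strong_induction_on with
  | _ n ih =>
  rcases n with _ | n
  · rw [PowerSeries.coeff_zero_eq_constantCoeff_apply, hg0]
  · have h := hconv n
    rw [Finset.Nat.antidiagonal_succ, Finset.sum_cons, h0, one_mul, Finset.sum_map] at h
    -- Each ratio `a (i + 1) / a i` with `i ≤ n` is at most `a (n + 1) / a n`, and the earlier
    -- coefficients of `g` are nonnegative.
    have hb : ∑ p ∈ antidiagonal n, a (p.1 + 1) * PowerSeries.coeff p.2 g ≤
        a (n + 1) / a n * ∑ p ∈ antidiagonal n, a p.1 * PowerSeries.coeff p.2 g := by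
      rw [Finset.mul_sum]
      refine Finset.sum_le_sum fun p hp => ?_
      have hpn := mem_antidiagonal.1 hp
      rw [← mul_assoc]
      refine mul_le_mul_of_nonneg_right ?_ (ih _ (by omega))
      rw [div_mul_eq_mul_div, le_div_iff₀ (hpos n), mul_comm (a (n + 1))]
      exact hlog _ _ (by omega)
    -- Equality holds for `n ≥ 1`; for `n = 0` the sum is zero.
    have hs : ∑ p ∈ antidiagonal n, a p.1 * PowerSeries.coeff p.2 g ≤ a n := by
      rcases n with _ | n
      · simp [hg0, (hpos 0).le]
      · exact (hconv n).le
    have hc : a (n + 1) / a n * ∑ p ∈ antidiagonal n, a p.1 * PowerSeries.coeff p.2 g ≤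
        a (n + 1) := by
      calc _ ≤ a (n + 1) / a n * a n :=
            mul_le_mul_of_nonneg_left hs (div_pos (hpos _) (hpos _)).le
        _ = a (n + 1) := div_mul_cancel₀ _ (hpos n).ne'
    simp only [Function.Embedding.coe_prodMap, Function.Embedding.coeFn_mk,
      Function.Embedding.refl_apply, Prod.map_fst, Prod.map_snd, Nat.succ_eq_add_one] at h
    linarith

theorem PowerSeries.coeff_pow_nonneg {g : PowerSeries ℝ} (hg : ∀ n, 0 ≤ PowerSeries.coeff n g)
    (j n : ℕ) : 0 ≤ PowerSeries.coeff n (g ^ j) := by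
  induction j generalizing n with
  | zero =>
    rw [pow_zero, PowerSeries.coeff_one]
    split_ifs <;> norm_num
  | succ j ih =>
    rw [pow_succ, PowerSeries.coeff_mul]
    exact Finset.sum_nonneg fun p _ => mul_nonneg (ih _) (hg _)

theorem PowerSeries.hasSum_coeff_mul {f g : PowerSeries ℝ} {y a b : ℝ}
    (ha : HasSum (fun n => PowerSeries.coeff n f * y ^ n) a)
    (hb : HasSum (fun n => PowerSeries.coeff n g * y ^ n) b) :
    HasSum (fun n => PowerSeries.coeff n (f * g) * y ^ n) (a * b) := by
  have h1 := ha.summable.norm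
  have h2 := hb.summable.norm
  have hs := (summable_norm_sum_mul_antidiagonal_of_summable_norm h1 h2).of_norm.hasSum
  rw [← tsum_mul_tsum_eq_tsum_sum_antidiagonal_of_summable_norm h1 h2, ha.tsum_eq,
    hb.tsum_eq] at hs
  refine Eq.mpr (congrArg (fun u => HasSum u (a * b)) (funext fun n => ?_)) hs
  rw [PowerSeries.coeff_mul, Finset.sum_mul]
  refine Finset.sum_congr rfl fun p hp => ?_
  rw [← Finset.HasAntidiagonal.mem_antidiagonal.1 hp, pow_add]
  ring

theorem PowerSeries.hasSum_coeff_pow {f : PowerSeries ℝ} {y a : ℝ}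
    (ha : HasSum (fun n => PowerSeries.coeff n f * y ^ n) a) (j : ℕ) :
    HasSum (fun n => PowerSeries.coeff n (f ^ j) * y ^ n) (a ^ j) := by
  induction j with
  | zero =>
    convert hasSum_single (f := fun n => PowerSeries.coeff n (f ^ 0) * y ^ n) 0 ?_
    · simp
    · intro n hn
      simp [PowerSeries.coeff_one, hn]
  | succ j ih =>
    rw [pow_succ, pow_succ]
    exact PowerSeries.hasSum_coeff_mul ih ha

/-! ### The expansion of `(artanh t / t)^s` -/

/-- The coefficients of `(artanh t / t) ^ s` as a power series in `t ^ 2`. -/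
noncomputable def artanhQuotCpowCoeff (s : ℂ) (m : ℕ) : ℂ :=
  ∑ k ∈ Finset.range (m + 1), (descPochhammer ℂ k).eval s / k.factorial *
    ((PowerSeries.coeff m ((artanhQuotSeries - 1) ^ k) : ℚ) : ℂ)

/-- The power series of `artanh t / t` in `t ^ 2` with real coefficients. -/
noncomputable def artanhQuotSeriesReal : PowerSeries ℝ := PowerSeries.mk fun n => 1 / (2 * n + 1)

/-- The power series `1 - t / artanh t` in `t ^ 2` with real coefficients. -/
noncomputable def oneSubInvArtanhQuot : PowerSeries ℝ := 1 - artanhQuotSeriesReal⁻¹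

theorem constantCoeff_artanhQuotSeriesReal :
    PowerSeries.constantCoeff artanhQuotSeriesReal = 1 := by
  rw [← PowerSeries.coeff_zero_eq_constantCoeff_apply, artanhQuotSeriesReal, PowerSeries.coeff_mk]
  simp

theorem artanhQuotSeriesReal_mul : artanhQuotSeriesReal * (1 - oneSubInvArtanhQuot) = 1 := by
  rw [oneSubInvArtanhQuot, sub_sub_cancel, PowerSeries.mul_inv_cancel]
  rw [constantCoeff_artanhQuotSeriesReal]
  exact one_ne_zero

theorem constantCoeff_oneSubInvArtanhQuot :
    PowerSeries.constantCoeff oneSubInvArtanhQuot = 0 := by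
  simp [oneSubInvArtanhQuot, constantCoeff_artanhQuotSeriesReal]

theorem coeff_artanhQuotSeriesReal_nonneg (n : ℕ) :
    0 ≤ PowerSeries.coeff n artanhQuotSeriesReal := by
  rw [artanhQuotSeriesReal, PowerSeries.coeff_mk]
  positivity

theorem coeff_oneSubInvArtanhQuot_nonneg (n : ℕ) :
    0 ≤ PowerSeries.coeff n oneSubInvArtanhQuot := by
  refine kaluza (a := fun n => 1 / (2 * n + 1)) (by simp) (fun n => by positivity)
    (fun i n hin => ?_) constantCoeff_oneSubInvArtanhQuot artanhQuotSeriesReal_mul n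
  have h : (i : ℝ) ≤ n := by exact_mod_cast hin
  push_cast
  -- After cross-multiplication the inequality reduces to `i ≤ n`.
  rw [div_mul_div_comm, div_mul_div_comm, one_mul, div_le_div_iff₀ (by positivity) (by positivity)]
  nlinarith

theorem artanhQuotCpowCoeff_eq (s : ℂ) (m : ℕ) :
    artanhQuotCpowCoeff s m = ∑ j ∈ Finset.range (m + 1), Ring.multichoose s j *
      ((PowerSeries.coeff m (oneSubInvArtanhQuot ^ j) : ℝ) : ℂ) := by
  have hF : PowerSeries.map (algebraMap ℚ ℂ) artanhQuotSeries =
      PowerSeries.map Complex.ofRealHom artanhQuotSeriesReal := by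
    ext n
    simp [artanhQuotSeries, artanhQuotSeriesReal]
  have h := PowerSeries.sum_choose_eq_sum_multichoose (K := ℂ)
    (w := PowerSeries.map (algebraMap ℚ ℂ) (artanhQuotSeries - 1))
    (g := PowerSeries.map Complex.ofRealHom oneSubInvArtanhQuot)
    (by simp [artanhQuotSeries, ← PowerSeries.coeff_zero_eq_constantCoeff_apply,
      -PowerSeries.coeff_zero_eq_constantCoeff])
    (by rw [← PowerSeries.coeff_zero_eq_constantCoeff_apply, PowerSeries.coeff_map,
        PowerSeries.coeff_zero_eq_constantCoeff_apply, constantCoeff_oneSubInvArtanhQuot, map_zero])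
    (by
      rw [map_sub, map_one, add_sub_cancel, hF]
      have := congrArg (PowerSeries.map Complex.ofRealHom) artanhQuotSeriesReal_mul
      rwa [map_mul, map_sub, map_one] at this) s m
  simp only [← map_pow, PowerSeries.coeff_map] at h
  simpa [artanhQuotCpowCoeff, Ring.choose_eq_eval_descPochhammer_div] using h

/-- Powers of `g = 1 - 1/F` have nonnegative coefficients, so bounding each rising factorial of `s`
by that of `N` bounds the whole sum. Expanding in `F - 1` would not give this: it would lead to `(2
- F)^{-N}`, singular where `F = 2`. -/
theorem norm_artanhQuotCpowCoeff_le (s : ℂ) (N : ℕ) (hs : ‖s‖ ≤ N) (m : ℕ) :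
    ‖artanhQuotCpowCoeff s m‖ ≤ PowerSeries.coeff m (artanhQuotSeriesReal ^ N) := by
  rw [artanhQuotCpowCoeff_eq, ← PowerSeries.sum_multichoose_mul_coeff_pow
    constantCoeff_oneSubInvArtanhQuot artanhQuotSeriesReal_mul]
  refine (norm_sum_le _ _).trans (Finset.sum_le_sum fun j _ => ?_)
  have hnn := PowerSeries.coeff_pow_nonneg coeff_oneSubInvArtanhQuot_nonneg j m
  rw [norm_mul, Complex.norm_real, Real.norm_of_nonneg hnn]
  exact mul_le_mul_of_nonneg_right (norm_multichoose_le s N hs j) hnn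

/-- The sum of `∑ y ^ n / (2 n + 1)`. -/
noncomputable def artanhQuot (y : ℝ) : ℝ := ∑' n : ℕ, 1 / (2 * n + 1) * y ^ n

theorem hasSum_artanhQuot {y : ℝ} (h0 : 0 ≤ y) (h1 : y < 1) :
    HasSum (fun n => PowerSeries.coeff n artanhQuotSeriesReal * y ^ n) (artanhQuot y) := by
  simp only [artanhQuotSeriesReal, PowerSeries.coeff_mk]
  refine Summable.hasSum (Summable.of_nonneg_of_le (fun n => by positivity) (fun n => ?_)
    (summable_geometric_of_lt_one h0 h1))
  refine mul_le_of_le_one_left (by positivity) ?_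
  rw [div_le_one (by positivity)]
  linarith [(Nat.cast_nonneg n : (0 : ℝ) ≤ n)]

theorem one_le_artanhQuot {y : ℝ} (h0 : 0 ≤ y) (h1 : y < 1) : 1 ≤ artanhQuot y := by
  have h := (hasSum_artanhQuot h0 h1).summable.le_tsum 0
    (fun n _ => mul_nonneg (coeff_artanhQuotSeriesReal_nonneg n) (pow_nonneg h0 n))
  rw [(hasSum_artanhQuot h0 h1).tsum_eq] at h
  simpa [constantCoeff_artanhQuotSeriesReal] using h

/-- The identity `F g = F - 1` with nonnegative coefficients and `F(0) = 1` gives `g ≤ F - 1`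
coefficientwise, hence convergence; the same identity then determines the value. -/
theorem hasSum_oneSubInvArtanhQuot {y : ℝ} (h0 : 0 ≤ y) (h1 : y < 1) :
    HasSum (fun n => PowerSeries.coeff n oneSubInvArtanhQuot * y ^ n)
      (1 - (artanhQuot y)⁻¹) := by
  have hF := hasSum_artanhQuot h0 h1
  have hmul : artanhQuotSeriesReal * oneSubInvArtanhQuot = artanhQuotSeriesReal - 1 := by
    linear_combination -artanhQuotSeriesReal_mul
  have hF1 : HasSum (fun n => PowerSeries.coeff n (artanhQuotSeriesReal - 1) * y ^ n)
      (artanhQuot y - 1) := by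
    have h2 := PowerSeries.hasSum_coeff_pow hF 0
    rw [pow_zero, pow_zero] at h2
    simpa only [map_sub, sub_mul] using hF.sub h2
  have hle : ∀ n, PowerSeries.coeff n oneSubInvArtanhQuot ≤
      PowerSeries.coeff n (artanhQuotSeriesReal - 1) := by
    intro n
    rw [← hmul, PowerSeries.coeff_mul]
    have := Finset.single_le_sum (f := fun p : ℕ × ℕ =>
      PowerSeries.coeff p.1 artanhQuotSeriesReal * PowerSeries.coeff p.2 oneSubInvArtanhQuot)
      (s := Finset.HasAntidiagonal.antidiagonal n)
      (fun p _ => mul_nonneg (coeff_artanhQuotSeriesReal_nonneg _)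
        (coeff_oneSubInvArtanhQuot_nonneg _)) (a := (0, n)) (by simp)
    simpa [constantCoeff_artanhQuotSeriesReal] using this
  have hs : Summable fun n => PowerSeries.coeff n oneSubInvArtanhQuot * y ^ n :=
    Summable.of_nonneg_of_le
      (fun n => mul_nonneg (coeff_oneSubInvArtanhQuot_nonneg n) (pow_nonneg h0 n))
      (fun n => mul_le_mul_of_nonneg_right (hle n) (pow_nonneg h0 n)) hF1.summable
  have h := PowerSeries.hasSum_coeff_mul hF hs.hasSum
  rw [hmul] at h
  have hu := h.unique hF1
  have hne : artanhQuot y ≠ 0 := by linarith [one_le_artanhQuot h0 h1]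
  convert hs.hasSum using 1
  field_simp
  linarith

theorem hasSum_multichoose (s u : ℂ) (hu : ‖u‖ < 1) :
    Summable (fun n : ℕ => ‖Ring.multichoose s n * u ^ n‖) ∧
      HasSum (fun n : ℕ => Ring.multichoose s n * u ^ n) (1 / (1 - u) ^ s) := by
  have h := Complex.one_div_one_sub_cpow_hasFPowerSeriesOnBall_zero s
  have hu' : u ∈ Metric.eball (0 : ℂ) 1 := by
    rw [← ENNReal.ofReal_one, Metric.eball_ofReal]
    simpa using hu
  have h1 := h.hasSum hu'
  have h2 := FormalMultilinearSeries.summable_norm_apply _ (Metric.eball_subset_eball h.r_le hu')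
  simp only [FormalMultilinearSeries.ofScalars_apply_eq, smul_eq_mul, zero_add,
    ← Ring.multichoose_eq] at h1 h2
  exact ⟨h2, h1⟩

/-- Here `u = g(y)` lies in `[0, 1)`, so the double series obtained from `(1 - u)^{-s}` by expanding
each `u^j` in powers of `y` converges absolutely, and may be summed over `j` first. -/
theorem hasSum_artanhQuotCpowCoeff (s : ℂ) {y : ℝ} (h0 : 0 ≤ y) (h1 : y < 1) :
    HasSum (fun m => artanhQuotCpowCoeff s m * (y : ℂ) ^ m) ((artanhQuot y : ℂ) ^ s) := by
  have hF := one_le_artanhQuot h0 h1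
  set u : ℝ := 1 - (artanhQuot y)⁻¹ with hu
  have hu0 : 0 ≤ u := by
    have := inv_le_one_of_one_le₀ hF
    linarith
  have hu1 : u < 1 := by
    have : 0 < (artanhQuot y)⁻¹ := by positivity
    linarith
  have hnn := PowerSeries.coeff_pow_nonneg coeff_oneSubInvArtanhQuot_nonneg
  have hpow : ∀ j, HasSum (fun m => PowerSeries.coeff m (oneSubInvArtanhQuot ^ j) * y ^ m)
      (u ^ j) := PowerSeries.hasSum_coeff_pow
    (hasSum_oneSubInvArtanhQuot h0 h1)
  obtain ⟨hs1, hs2⟩ := hasSum_multichoose s (u : ℂ)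
    (by rwa [Complex.norm_real, Real.norm_of_nonneg hu0])
  let f : ℕ × ℕ → ℂ := fun p => Ring.multichoose s p.1 *
    (((PowerSeries.coeff p.2 (oneSubInvArtanhQuot ^ p.1) * y ^ p.2 : ℝ)) : ℂ)
  have hfn : ∀ j m, ‖f (j, m)‖ = ‖Ring.multichoose s j‖ *
      (PowerSeries.coeff m (oneSubInvArtanhQuot ^ j) * y ^ m) := by
    intro j m
    simp only [f]
    rw [norm_mul, Complex.norm_real,
      Real.norm_of_nonneg (mul_nonneg (hnn j m) (pow_nonneg h0 m))]
  have hf : Summable f := by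
    refine Summable.of_norm ((summable_prod_of_nonneg (fun p => norm_nonneg _)).2 ⟨fun j => ?_, ?_⟩)
    · simp only [hfn]
      exact (hpow j).summable.mul_left _
    · simp only [hfn, tsum_mul_left, (hpow _).tsum_eq]
      refine hs1.congr fun j => ?_
      rw [norm_mul, norm_pow, Complex.norm_real, Real.norm_of_nonneg hu0]
  have hsum : HasSum f (1 / (1 - (u : ℂ)) ^ s) := by
    have h := hf.hasSum.prod_fiberwise fun j => ((Complex.hasSum_ofReal.2 (hpow j)).mul_left
      (Ring.multichoose s j))
    have h3 : HasSum (fun j => Ring.multichoose s j * (u : ℂ) ^ j) (∑' p, f p) := by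
      simpa using h
    rw [← h3.unique hs2]
    exact hf.hasSum
  have hval : 1 / (1 - (u : ℂ)) ^ s = (artanhQuot y : ℂ) ^ s := by
    rw [hu]
    push_cast
    rw [sub_sub_cancel, Complex.inv_cpow, one_div, inv_inv]
    rw [Complex.arg_ofReal_of_nonneg (by linarith)]
    exact Real.pi_pos.ne
  rw [hval] at hsum
  have hswap := (Equiv.prodComm ℕ ℕ).hasSum_iff.2 hsum
  refine hswap.prod_fiberwise fun m => ?_
  have : artanhQuotCpowCoeff s m * (y : ℂ) ^ m =
      ∑ j ∈ Finset.range (m + 1), f (j, m) := by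
    rw [artanhQuotCpowCoeff_eq, Finset.sum_mul]
    refine Finset.sum_congr rfl fun j _ => ?_
    simp [f, mul_assoc]
  rw [this]
  refine hasSum_sum_of_ne_finset_zero fun j hj => ?_
  simp [f, PowerSeries.coeff_pow_eq_zero_of_constantCoeff constantCoeff_oneSubInvArtanhQuot
    (by simpa using hj : m < j)]

/-! ### The zeta-Gamma product as a Mellin transform -/

section ZetaGamma

open Filter Topology MeasureTheory Set

/-- The residue 1 of `ζ` multiplies the derivative `log 2` of `1 - 2^{1-s}` at 1, and `Γ(1) = 1`. -/
theorem continuousAt_zetaGammaProduct_one : ContinuousAt zetaGammaProduct 1 := by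
  have hupd : zetaGammaProduct = Function.update
      (fun s => riemannZeta s * (1 - 2 ^ (1 - s)) * Complex.Gamma s) 1 (Real.log 2 : ℂ) := by
    funext s
    by_cases h : s = 1
    · simp [zetaGammaProduct, h]
    · simp [zetaGammaProduct, h]
  rw [hupd, continuousAt_update_same]
  have hd : HasDerivAt (fun s : ℂ => 1 - (2 : ℂ) ^ (1 - s)) (Real.log 2 : ℂ) 1 := by
    have h := ((hasDerivAt_id (1 : ℂ)).const_sub 1).const_cpow (c := 2) (Or.inl two_ne_zero)
    have h2 := h.const_sub 1
    simpa [Complex.ofReal_log] using h2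
  have h1 := hd.tendsto_slope
  have hG : Tendsto Complex.Gamma (𝓝[≠] 1) (𝓝 (Complex.Gamma 1)) := by
    refine (Complex.differentiableAt_Gamma 1 fun m h => ?_).continuousAt.tendsto.mono_left
      nhdsWithin_le_nhds
    have := congrArg Complex.re h
    simp only [Complex.one_re, Complex.neg_re, Complex.natCast_re] at this
    linarith [(Nat.cast_nonneg m : (0 : ℝ) ≤ m)]
  have h := (riemannZeta_residue_one.mul h1).mul hG
  rw [Complex.Gamma_one, one_mul, mul_one] at h
  refine h.congr' ?_
  filter_upwards [self_mem_nhdsWithin] with s hs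
  have hs' : s - 1 ≠ 0 := sub_ne_zero.2 hs
  rw [slope_def_field]
  simp only [sub_self, Complex.cpow_zero, sub_zero]
  field_simp

theorem differentiableAt_zetaGammaProduct {s : ℂ} (hs : 0 < s.re) (h1 : s ≠ 1) :
    DifferentiableAt ℂ zetaGammaProduct s := by
  have heq : zetaGammaProduct =ᶠ[𝓝 s]
      fun s => riemannZeta s * (1 - 2 ^ (1 - s)) * Complex.Gamma s := by
    filter_upwards [isOpen_ne.mem_nhds h1] with z hz
    rw [zetaGammaProduct, if_neg hz]
  refine DifferentiableAt.congr_of_eventuallyEq ?_ heq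
  refine ((differentiableAt_riemannZeta h1).mul ?_).mul
    (Complex.differentiableAt_Gamma s fun m h => ?_)
  · exact (((differentiableAt_id.const_sub 1).const_cpow (Or.inl two_ne_zero)).const_sub 1)
  · have := congrArg Complex.re h
    simp only [Complex.neg_re, Complex.natCast_re] at this
    linarith [(Nat.cast_nonneg m : (0 : ℝ) ≤ m)]

theorem continuousAt_zetaGammaProduct {s : ℂ} (hs : 0 < s.re) :
    ContinuousAt zetaGammaProduct s := by
  by_cases h1 : s = 1
  · exact h1 ▸ continuousAt_zetaGammaProduct_one
  · exact (differentiableAt_zetaGammaProduct hs h1).continuousAt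

theorem differentiableOn_zetaGammaProduct :
    DifferentiableOn ℂ zetaGammaProduct {s | 0 < s.re} := by
  have hopen : IsOpen {s : ℂ | 0 < s.re} := isOpen_lt continuous_const Complex.continuous_re
  refine (Complex.differentiableOn_compl_singleton_and_continuousAt_iff (c := 1)
    (hopen.mem_nhds (by simp))).1 ⟨fun s hs => ?_, continuousAt_zetaGammaProduct_one⟩
  exact (differentiableAt_zetaGammaProduct hs.1 hs.2).differentiableWithinAt

/-- The derivative of `-1 / (e ^ x + 1)`. -/
noncomputable def logisticDensity (x : ℝ) : ℂ := ((Real.exp x / (Real.exp x + 1) ^ 2 : ℝ) : ℂ)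

theorem continuous_logisticDensity : Continuous logisticDensity := by
  unfold logisticDensity
  refine Complex.continuous_ofReal.comp (Real.continuous_exp.div (by fun_prop) fun x => ?_)
  positivity

theorem norm_logisticDensity_le (x : ℝ) : ‖logisticDensity x‖ ≤ Real.exp (-1 * x) := by
  rw [logisticDensity, Complex.norm_real, Real.norm_of_nonneg (by positivity),
    div_le_iff₀ (by positivity), neg_one_mul, Real.exp_neg, ← div_eq_inv_mul,
    le_div_iff₀ (Real.exp_pos x)]
  nlinarith [Real.exp_pos x]

theorem logisticDensity_isBigO_atTop :
    logisticDensity =O[atTop] fun t => Real.exp (-1 * t) :=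
  Asymptotics.IsBigO.of_bound 1 (Eventually.of_forall fun x => by
    rw [one_mul, Real.norm_of_nonneg (Real.exp_pos _).le]
    exact norm_logisticDensity_le x)

theorem logisticDensity_isBigO_zero :
    logisticDensity =O[𝓝[>] 0] fun t : ℝ => t ^ (-(0 : ℝ)) := by
  refine Asymptotics.IsBigO.of_bound 1 ?_
  filter_upwards [self_mem_nhdsWithin] with x hx
  have hx' : (0 : ℝ) < x := hx
  rw [neg_zero, Real.rpow_zero, norm_one, mul_one]
  refine (norm_logisticDensity_le x).trans (Real.exp_le_one_iff.2 (by linarith))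

theorem mellinConvergent_logisticDensity {s : ℂ} (hs : 0 < s.re) :
    MellinConvergent logisticDensity s :=
  mellinConvergent_of_isBigO_rpow_exp one_pos
    (continuous_logisticDensity.locallyIntegrable.locallyIntegrableOn _)
    logisticDensity_isBigO_atTop logisticDensity_isBigO_zero hs

theorem differentiableAt_mellin_logisticDensity {s : ℂ} (hs : 0 < s.re) :
    DifferentiableAt ℂ (mellin logisticDensity) s :=
  mellin_differentiableAt_of_isBigO_rpow_exp one_pos
    (continuous_logisticDensity.locallyIntegrable.locallyIntegrableOn _)
    logisticDensity_isBigO_atTop logisticDensity_isBigO_zero hs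

/-- This is `-∑ n z^n = -z/(1 - z)^2` at `z = -e^{-x}`. -/
theorem hasSum_logisticDensity {x : ℝ} (hx : 0 < x) :
    HasSum (fun n : ℕ => (-(-1 : ℂ) ^ n * n) * (Real.exp (-(n : ℝ) * x) : ℂ))
      (logisticDensity x) := by
  have hlt : ‖-Real.exp (-x)‖ < 1 := by
    rw [norm_neg, Real.norm_of_nonneg (Real.exp_pos _).le, Real.exp_lt_one_iff]
    linarith
  have h := Complex.hasSum_ofReal.2 (hasSum_coe_mul_geometric_of_norm_lt_one hlt).neg
  have hval : -(-Real.exp (-x) / (1 - -Real.exp (-x)) ^ 2) =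
      Real.exp x / (Real.exp x + 1) ^ 2 := by
    rw [Real.exp_neg, sub_neg_eq_add]
    have := Real.exp_pos x
    field_simp
  rw [hval] at h
  refine Eq.mpr (congrArg (fun u => HasSum u (logisticDensity x)) (funext fun n => ?_)) h
  rw [show -(n : ℝ) * x = n * -x by ring, Real.exp_nat_mul, neg_pow]
  push_cast
  ring

/-- The Dirichlet eta function as a multiple of the zeta function. -/
theorem hasSum_eta {s : ℂ} (hs : 1 < s.re) :
    HasSum (fun n : ℕ => -(-1 : ℂ) ^ n * (1 / (n : ℂ) ^ s))
      (riemannZeta s * (1 - 2 ^ (1 - s))) := by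
  -- The index `n = 0` contributes nothing: `0 ^ s = 0` for `s ≠ 0`, and `1 / 0 = 0`.
  have hsum : Summable fun n : ℕ => 1 / (n : ℂ) ^ s := Complex.summable_one_div_nat_cpow.2 hs
  have hz : HasSum (fun n : ℕ => 1 / (n : ℂ) ^ s) (riemannZeta s) := by
    rw [zeta_eq_tsum_one_div_nat_cpow hs]
    exact hsum.hasSum
  have he : HasSum (fun n : ℕ => 1 / ((2 * n : ℕ) : ℂ) ^ s) (2 ^ (-s) * riemannZeta s) := by
    refine Eq.mpr (congrArg (fun u => HasSum u _) (funext fun n => ?_)) (hz.mul_left (2 ^ (-s)))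
    rw [Nat.cast_mul, Complex.natCast_mul_natCast_cpow, Complex.cpow_neg, Nat.cast_ofNat]
    field_simp
  have ho : Summable fun n : ℕ => 1 / ((2 * n + 1 : ℕ) : ℂ) ^ s :=
    hsum.comp_injective (i := fun n => 2 * n + 1) fun a b h => by simpa using h
  have hO := (HasSum.even_add_odd (f := fun n : ℕ => 1 / (n : ℂ) ^ s) he ho.hasSum).unique hz
  have h2 : (2 : ℂ) ^ (1 - s) = 2 * 2 ^ (-s) := by
    rw [sub_eq_add_neg, Complex.cpow_add _ _ two_ne_zero, Complex.cpow_one]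
  have hval : riemannZeta s * (1 - 2 ^ (1 - s)) =
      -(2 ^ (-s) * riemannZeta s) + ∑' n : ℕ, 1 / ((2 * n + 1 : ℕ) : ℂ) ^ s := by
    rw [h2]
    linear_combination -hO
  rw [hval]
  refine HasSum.even_add_odd (f := fun n : ℕ => -(-1 : ℂ) ^ n * (1 / (n : ℂ) ^ s))
    (Eq.mpr (congrArg (fun u => HasSum u _) (funext fun n => ?_)) he.neg)
    (Eq.mpr (congrArg (fun u => HasSum u _) (funext fun n => ?_)) ho.hasSum)
  · rw [(even_two_mul n).neg_one_pow, neg_one_mul]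
  · rw [(odd_two_mul_add_one n).neg_one_pow, neg_neg, one_mul]

/-- Termwise Mellin transform: the factor `n` lowers `n^{-(s+1)}` to `n^{-s}`, leaving `Γ(s+1)`
times the eta series. Absolute summability is what requires `Re s > 1`. -/
theorem mellin_logisticDensity_of_one_lt_re {s : ℂ} (hs : 1 < s.re) :
    mellin logisticDensity (s + 1) = s * zetaGammaProduct s := by
  have hs0 : s ≠ 0 := fun h => by simp [h] at hs; linarith
  have hs1 : s ≠ 1 := fun h => by simp [h] at hs
  have h := hasSum_mellin (a := fun n : ℕ => -(-1 : ℂ) ^ n * n) (p := fun n : ℕ => (n : ℝ))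
    (F := logisticDensity) (s := s + 1) (fun n => ?_)
    (by simp; linarith) (fun t ht => hasSum_logisticDensity ht) ?_
  · refine h.unique ?_
    rw [zetaGammaProduct, if_neg hs1]
    have h2 := (hasSum_eta hs).mul_left (Complex.Gamma (s + 1))
    rw [show s * (riemannZeta s * (1 - 2 ^ (1 - s)) * Complex.Gamma s) =
      Complex.Gamma (s + 1) * (riemannZeta s * (1 - 2 ^ (1 - s))) by
        rw [Complex.Gamma_add_one s hs0]; ring]
    refine Eq.mpr (congrArg (fun u => HasSum u _) (funext fun n => ?_)) h2
    rcases eq_or_ne n 0 with rfl | hn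
    · simp [Complex.zero_cpow hs0]
    · have hn' : (n : ℂ) ≠ 0 := by exact_mod_cast hn
      have hp : (n : ℂ) ^ s ≠ 0 := by simp [Complex.cpow_eq_zero_iff, hn']
      rw [Complex.ofReal_natCast, Complex.cpow_add _ _ hn', Complex.cpow_one]
      field_simp
  · rcases eq_or_ne n 0 with rfl | hn
    · left; simp
    · right; positivity
  · refine (Real.summable_one_div_nat_rpow.2 hs).congr fun n => ?_
    rcases eq_or_ne n 0 with rfl | hn
    · simp [Real.zero_rpow (by linarith : s.re ≠ 0)]
    · have hn' : (0 : ℝ) < n := by positivity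
      rw [Complex.add_re, Complex.one_re, Real.rpow_add hn', Real.rpow_one]
      simp
      field_simp

/-- Identity theorem on the half-plane `Re s > 0`: both sides are analytic there and agree near `s =
2`. -/
theorem mellin_logisticDensity {s : ℂ} (hs : 0 < s.re) :
    mellin logisticDensity (s + 1) = s * zetaGammaProduct s := by
  have hopen : IsOpen {s : ℂ | 0 < s.re} := isOpen_lt continuous_const Complex.continuous_re
  have hf : AnalyticOnNhd ℂ (fun s => mellin logisticDensity (s + 1)) {s | 0 < s.re} := by
    refine DifferentiableOn.analyticOnNhd (fun z hz => ?_) hopen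
    have hz' : 0 < (z + 1).re := by
      have : 0 < z.re := hz
      simp only [Complex.add_re, Complex.one_re]
      linarith
    exact ((differentiableAt_mellin_logisticDensity hz').comp z
      (differentiableAt_id.add_const 1)).differentiableWithinAt
  have hg : AnalyticOnNhd ℂ (fun s => s * zetaGammaProduct s) {s | 0 < s.re} :=
    DifferentiableOn.analyticOnNhd (differentiableOn_id.mul differentiableOn_zetaGammaProduct) hopen
  have hconn : IsPreconnected {s : ℂ | 0 < s.re} :=
    (convex_halfSpace_re_gt 0).isPreconnected
  refine hf.eqOn_of_preconnected_of_eventuallyEq hg hconn (z₀ := 2) (by simp) ?_ hs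
  have h1 : {s : ℂ | 1 < s.re} ∈ 𝓝 (2 : ℂ) :=
    (isOpen_lt continuous_const Complex.continuous_re).mem_nhds (by simp)
  filter_upwards [h1] with z hz
  exact mellin_logisticDensity_of_one_lt_re hz

end ZetaGamma

/-! ### The substitution `t = tanh (x/2)` and termwise integration -/

section ChangeOfVariables

open Filter Topology MeasureTheory Set

/-- `tanh (x / 2)`. -/
noncomputable def tanhHalf (x : ℝ) : ℝ := 1 - 2 / (Real.exp x + 1)

theorem hasDerivAt_tanhHalf (x : ℝ) :
    HasDerivAt tanhHalf (2 * (Real.exp x / (Real.exp x + 1) ^ 2)) x := by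
  have hne : Real.exp x + 1 ≠ 0 := by positivity
  have h := (((hasDerivAt_const x (2 : ℝ)).div ((Real.hasDerivAt_exp x).add_const 1) hne).const_sub
    1)
  exact HasDerivAt.congr_deriv h (by field_simp; ring)

theorem injective_tanhHalf : Function.Injective tanhHalf := by
  intro x y h
  unfold tanhHalf at h
  have hx : Real.exp x + 1 ≠ 0 := by positivity
  have hy : Real.exp y + 1 ≠ 0 := by positivity
  have h2 : 2 / (Real.exp x + 1) = 2 / (Real.exp y + 1) := by linarith
  rw [div_eq_div_iff hx hy] at h2
  exact Real.exp_injective (by linarith)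

theorem tanhHalf_mem_Ioo {x : ℝ} (hx : 0 < x) : tanhHalf x ∈ Ioo (0 : ℝ) 1 := by
  have h1 : 1 < Real.exp x := Real.one_lt_exp_iff.2 hx
  have h2 : 2 / (Real.exp x + 1) < 1 := by
    rw [div_lt_one (by positivity)]
    linarith
  have h3 : 0 < 2 / (Real.exp x + 1) := by positivity
  unfold tanhHalf
  constructor <;> linarith

theorem image_tanhHalf : tanhHalf '' Ioi 0 = Ioo 0 1 := by
  refine Subset.antisymm (by rintro _ ⟨x, hx, rfl⟩; exact tanhHalf_mem_Ioo hx) ?_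
  rintro t ⟨h0, h1⟩
  have h2 : 0 < (1 + t) / (1 - t) := div_pos (by linarith) (by linarith)
  refine ⟨Real.log ((1 + t) / (1 - t)), Real.log_pos ?_, ?_⟩
  · rw [lt_div_iff₀ (by linarith)]
    linarith
  · rw [tanhHalf, Real.exp_log h2]
    have : 1 - t ≠ 0 := by linarith
    field_simp
    ring

theorem mul_artanhQuot_sq {t : ℝ} (h0 : 0 ≤ t) (h1 : t < 1) :
    t * artanhQuot (t ^ 2) = (Real.log (1 + t) - Real.log (1 - t)) / 2 := by
  have h := Real.hasSum_log_sub_log_of_abs_lt_one (x := t) (by rwa [abs_of_nonneg h0])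
  have h2 := (hasSum_artanhQuot (sq_nonneg t) (by nlinarith)).mul_left (2 * t)
  have h3 : HasSum (fun k : ℕ => (2 : ℝ) * (1 / (2 * k + 1)) * t ^ (2 * k + 1))
      (2 * t * artanhQuot (t ^ 2)) := by
    refine Eq.mpr (congrArg (fun u => HasSum u _) (funext fun n => ?_)) h2
    rw [artanhQuotSeriesReal, PowerSeries.coeff_mk, pow_succ, pow_mul]
    ring
  linarith [h3.unique h]

theorem tanhHalf_mul_artanhQuot {x : ℝ} (hx : 0 < x) :
    tanhHalf x * artanhQuot (tanhHalf x ^ 2) = x / 2 := by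
  have h := tanhHalf_mem_Ioo hx
  rw [mul_artanhQuot_sq h.1.le h.2, ← Real.log_div (by linarith [h.1]) (by linarith [h.2])]
  congr 1
  have : (1 + tanhHalf x) / (1 - tanhHalf x) = Real.exp x := by
    unfold tanhHalf
    have : Real.exp x + 1 ≠ 0 := by positivity
    field_simp
    ring
  rw [this, Real.log_exp]

/-- The integrand `(artanh t) ^ s`. -/
noncomputable def artanhCpow (s : ℂ) (t : ℝ) : ℂ := ((t * artanhQuot (t ^ 2) : ℝ) : ℂ) ^ s

theorem deriv_smul_artanhCpow (s : ℂ) {x : ℝ} (hx : 0 < x) :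
    |2 * (Real.exp x / (Real.exp x + 1) ^ 2)| • artanhCpow s (tanhHalf x) =
      2 ^ (1 - s) * ((x : ℂ) ^ (s + 1 - 1) • logisticDensity x) := by
  rw [artanhCpow, tanhHalf_mul_artanhQuot hx, abs_of_pos (by positivity), logisticDensity,
    add_sub_cancel_right, smul_eq_mul, Complex.real_smul, Complex.cpow_sub _ _ two_ne_zero,
    Complex.cpow_one]
  have h : ((x / 2 : ℝ) : ℂ) ^ s = (x : ℂ) ^ s / 2 ^ s := by
    have h2 := Complex.mul_cpow_ofReal_nonneg (a := x / 2) (b := 2) (by positivity) two_pos.le s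
    have hp : (2 : ℂ) ^ s ≠ 0 := by simp [Complex.cpow_eq_zero_iff]
    rw [eq_div_iff hp]
    rw [← Complex.ofReal_mul, div_mul_cancel₀ _ two_ne_zero] at h2
    simpa using h2.symm
  rw [h]
  push_cast
  ring

theorem integrableOn_artanhCpow {s : ℂ} (hs : 0 < s.re) :
    IntegrableOn (artanhCpow s) (Ioo 0 1) := by
  rw [← image_tanhHalf, integrableOn_image_iff_integrableOn_abs_deriv_smul measurableSet_Ioi
    (fun x _ => (hasDerivAt_tanhHalf x).hasDerivWithinAt) injective_tanhHalf.injOn]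
  have h : MellinConvergent logisticDensity (s + 1) :=
    mellinConvergent_logisticDensity (by simp only [Complex.add_re, Complex.one_re]; linarith)
  exact IntegrableOn.congr_fun (h.const_mul (2 ^ (1 - s)))
    (fun x hx => (deriv_smul_artanhCpow s hx).symm) measurableSet_Ioi

theorem zetaGammaProduct_eq_integral {s : ℂ} (hs : 0 < s.re) :
    zetaGammaProduct s = 2 ^ (s - 1) / s * ∫ t in Ioo (0 : ℝ) 1, artanhCpow s t := by
  have hs0 : s ≠ 0 := fun h => by simp [h] at hs
  rw [← image_tanhHalf, integral_image_eq_integral_abs_deriv_smul measurableSet_Ioi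
    (fun x _ => (hasDerivAt_tanhHalf x).hasDerivWithinAt) injective_tanhHalf.injOn,
    setIntegral_congr_fun measurableSet_Ioi (fun x hx => deriv_smul_artanhCpow s hx),
    integral_const_mul]
  change _ = _ * (_ * mellin logisticDensity (s + 1))
  rw [mellin_logisticDensity hs]
  have h2 : (2 : ℂ) ^ (s - 1) * 2 ^ (1 - s) = 1 := by
    rw [← Complex.cpow_add _ _ two_ne_zero]
    simp
  field_simp
  linear_combination -zetaGammaProduct s * h2

theorem integral_Ioo_cpow {r : ℂ} (hr : 0 < r.re) :
    ∫ t in Ioo (0 : ℝ) 1, (t : ℂ) ^ r = 1 / (r + 1) := by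
  rw [← integral_Ioc_eq_integral_Ioo, ← intervalIntegral.integral_of_le zero_le_one,
    integral_cpow (Or.inl (by linarith))]
  have : r + 1 ≠ 0 := fun h => by
    have := congrArg Complex.re h
    simp only [Complex.add_re, Complex.one_re, Complex.zero_re] at this
    linarith
  simp [Complex.zero_cpow this]

theorem integral_Ioo_rpow {r : ℝ} (hr : 0 < r) :
    ∫ t in Ioo (0 : ℝ) 1, t ^ r = 1 / (r + 1) := by
  rw [← integral_Ioc_eq_integral_Ioo, ← intervalIntegral.integral_of_le zero_le_one,
    integral_rpow (Or.inl (by linarith))]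
  simp [Real.zero_rpow (by linarith : r + 1 ≠ 0)]

theorem integrableOn_Ioo_rpow {r : ℝ} (hr : 0 < r) :
    IntegrableOn (fun t : ℝ => t ^ r) (Ioo 0 1) :=
  ((intervalIntegrable_iff_integrableOn_Ioc_of_le zero_le_one).1
    (intervalIntegral.intervalIntegrable_rpow' (by linarith))).mono_set Ioo_subset_Ioc_self

theorem integrableOn_Ioo_cpow {r : ℂ} (hr : 0 < r.re) :
    IntegrableOn (fun t : ℝ => (t : ℂ) ^ r) (Ioo 0 1) :=
  ((intervalIntegrable_iff_integrableOn_Ioc_of_le zero_le_one).1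
    (intervalIntegral.intervalIntegrable_cpow' (by linarith))).mono_set Ioo_subset_Ioc_self

/-- The terms are nonnegative, and each partial sum is the integral of a partial sum of the
expansion of `(artanh t)^N`, hence at most the finite integral of that function. -/
theorem summable_coeff_artanhQuotSeriesReal_pow {N : ℕ} (hN : 0 < N) :
    Summable fun m : ℕ => PowerSeries.coeff m (artanhQuotSeriesReal ^ N) *
      (1 / (N + 2 * m + 1 : ℝ)) := by
  have hnn := PowerSeries.coeff_pow_nonneg coeff_artanhQuotSeriesReal_nonneg N
  have hN' : (0 : ℝ) < N := by exact_mod_cast hN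
  have hint : IntegrableOn (fun t : ℝ => (t * artanhQuot (t ^ 2)) ^ N) (Ioo 0 1) := by
    have h := (integrableOn_artanhCpow (s := (N : ℂ)) (by simpa using hN)).re
    refine IntegrableOn.congr_fun h (fun t _ => ?_) measurableSet_Ioo
    simp only [artanhCpow, Complex.cpow_natCast, RCLike.re_to_complex]
    rw [← Complex.ofReal_pow, Complex.ofReal_re]
  have hterm : ∀ m : ℕ, IntegrableOn (fun t : ℝ =>
      PowerSeries.coeff m (artanhQuotSeriesReal ^ N) * t ^ (N + 2 * m : ℝ)) (Ioo 0 1) := fun m =>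
    (integrableOn_Ioo_rpow (by positivity)).const_mul _
  refine summable_of_sum_le (c := ∫ t in Ioo (0 : ℝ) 1, (t * artanhQuot (t ^ 2)) ^ N)
    (fun m => mul_nonneg (hnn m) (by positivity)) fun u => ?_
  have heq : ∑ m ∈ u, PowerSeries.coeff m (artanhQuotSeriesReal ^ N) * (1 / (N + 2 * m + 1 : ℝ)) =
      ∫ t in Ioo (0 : ℝ) 1, ∑ m ∈ u, PowerSeries.coeff m (artanhQuotSeriesReal ^ N) *
        t ^ (N + 2 * m : ℝ) := by
    rw [integral_finsetSum _ fun m _ => hterm m]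
    refine Finset.sum_congr rfl fun m _ => ?_
    rw [integral_const_mul, integral_Ioo_rpow (by positivity)]
  rw [heq]
  refine setIntegral_mono_on (integrable_finsetSum _ fun m _ => hterm m) hint measurableSet_Ioo
    fun t ht => ?_
  have hF := PowerSeries.hasSum_coeff_pow
    (hasSum_artanhQuot (sq_nonneg t) (by nlinarith [ht.1, ht.2])) N
  have hle := sum_le_hasSum u (fun m _ => mul_nonneg (hnn m) (pow_nonneg (sq_nonneg t) m)) hF
  rw [mul_pow]
  refine le_trans (le_of_eq ?_) (mul_le_mul_of_nonneg_left hle (pow_nonneg ht.1.le N))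
  rw [Finset.mul_sum]
  refine Finset.sum_congr rfl fun m _ => ?_
  rw [show (N + 2 * m : ℝ) = ((N + 2 * m : ℕ) : ℝ) by push_cast; ring, Real.rpow_natCast, pow_add,
    pow_mul]
  ring

theorem hasSum_integral_artanhCpow {s : ℂ} (hs : 0 < s.re) :
    HasSum (fun m : ℕ => 1 / (s + 2 * m + 1) * artanhQuotCpowCoeff s m)
      (∫ t in Ioo (0 : ℝ) 1, artanhCpow s t) := by
  obtain ⟨N, hN⟩ := exists_nat_ge ‖s‖
  have hN0 : 0 < N := by
    have : (0 : ℝ) < N := (norm_pos_iff.2 fun h => by simp [h] at hs).trans_le hN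
    exact_mod_cast this
  have hre : ∀ m : ℕ, 0 < (s + 2 * m).re := fun m => by
    have : (s + 2 * m).re = s.re + 2 * m := by simp
    rw [this]
    positivity
  let F : ℕ → ℝ → ℂ := fun m t => artanhQuotCpowCoeff s m * (t : ℂ) ^ (s + 2 * m)
  have hFint : ∀ m, Integrable (F m) (volume.restrict (Ioo 0 1)) := fun m =>
    (integrableOn_Ioo_cpow (hre m)).const_mul _
  have hnorm : ∀ m, ∫ t in Ioo (0 : ℝ) 1, ‖F m t‖ =
      ‖artanhQuotCpowCoeff s m‖ * (1 / (s.re + 2 * m + 1)) := by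
    intro m
    rw [← integral_Ioo_rpow (by positivity), ← integral_const_mul]
    refine setIntegral_congr_fun measurableSet_Ioo fun t ht => ?_
    simp only [F]
    rw [norm_mul, Complex.norm_cpow_eq_rpow_re_of_pos ht.1]
    simp
  have hsum : Summable fun m => ∫ t in Ioo (0 : ℝ) 1, ‖F m t‖ := by
    simp only [hnorm]
    refine Summable.of_nonneg_of_le (fun m => by positivity) (fun m => ?_)
      ((summable_coeff_artanhQuotSeriesReal_pow hN0).mul_left (N + 1 : ℝ))
    have h1 := norm_artanhQuotCpowCoeff_le s N hN m
    -- The factor `N + 1` works since `(N + 1)(2m + 1) ≥ N + 2m + 1`; it allows comparison with the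
    -- series for the exponent `N`.
    have h2 : 1 / (s.re + 2 * m + 1) ≤ (N + 1 : ℝ) * (1 / (N + 2 * m + 1)) := by
      rw [mul_one_div, div_le_div_iff₀ (by positivity) (by positivity)]
      nlinarith [(Nat.cast_nonneg N : (0 : ℝ) ≤ N), (Nat.cast_nonneg m : (0 : ℝ) ≤ m),
        mul_nonneg (Nat.cast_nonneg N : (0 : ℝ) ≤ N) (Nat.cast_nonneg m : (0 : ℝ) ≤ m),
        mul_nonneg (Nat.cast_nonneg N : (0 : ℝ) ≤ N) hs.le]
    calc _ ≤ PowerSeries.coeff m (artanhQuotSeriesReal ^ N) *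
          ((N + 1 : ℝ) * (1 / (N + 2 * m + 1))) :=
          mul_le_mul h1 h2 (by positivity) ((norm_nonneg _).trans h1)
      _ = _ := by ring
  have h := hasSum_integral_of_summable_integral_norm hFint hsum
  have hval : ∫ t in Ioo (0 : ℝ) 1, ∑' m, F m t = ∫ t in Ioo (0 : ℝ) 1, artanhCpow s t := by
    refine setIntegral_congr_fun measurableSet_Ioo fun t ht => ?_
    have ht2 : t ^ 2 < 1 := by nlinarith [ht.1, ht.2]
    have h3 := (hasSum_artanhQuotCpowCoeff s (sq_nonneg t) ht2).mul_left ((t : ℂ) ^ s)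
    have hF := one_le_artanhQuot (sq_nonneg t) ht2
    have ht0 : (t : ℂ) ≠ 0 := by exact_mod_cast ht.1.ne'
    simp only [artanhCpow]
    rw [Complex.ofReal_mul, Complex.mul_cpow_ofReal_nonneg ht.1.le (by linarith), ← h3.tsum_eq]
    refine tsum_congr fun m => ?_
    simp only [F]
    rw [Complex.cpow_add _ _ ht0, show (2 * m : ℂ) = ((2 * m : ℕ) : ℂ) by push_cast; ring,
      Complex.cpow_natCast, pow_mul]
    push_cast
    ring
  rw [hval] at h
  refine Eq.mpr (congrArg (fun u => HasSum u _) (funext fun m => ?_)) h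
  simp only [F]
  rw [integral_const_mul, integral_Ioo_cpow (hre m), mul_comm]

end ChangeOfVariables

/-! ### Identification of the coefficients and conclusion -/

theorem artanhQuotCpowCoeff_zero (s : ℂ) : artanhQuotCpowCoeff s 0 = 1 := by
  simp [artanhQuotCpowCoeff]

/-- The term `k = 0` drops out because `(F - 1)^0 = 1` has no coefficient in positive degree. -/
theorem sum_bCoeff_eq_artanhQuotCpowCoeff (s : ℂ) (m : ℕ) :
    ∑ k ∈ Finset.Icc 1 (m + 1), (bCoeff (2 * (m + 1)) k : ℂ) / ((2 * (m + 1) + k).factorial : ℂ) *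
      (descPochhammer ℂ k).eval s = artanhQuotCpowCoeff s (m + 1) := by
  have hr : Finset.range (m + 1 + 1) = insert 0 (Finset.Icc 1 (m + 1)) := by
    ext k
    simp only [Finset.mem_range, Finset.mem_insert, Finset.mem_Icc]
    omega
  rw [artanhQuotCpowCoeff, hr, Finset.sum_insert (by simp), pow_zero, PowerSeries.coeff_one,
    if_neg m.succ_ne_zero, Rat.cast_zero, mul_zero, zero_add]
  refine Finset.sum_congr rfl fun k _ => ?_
  have h := congrArg (fun q : ℚ => (q : ℂ)) (bCoeff_even (m + 1) k)
  push_cast at h ⊢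
  rw [h]
  ring

theorem sum_bCoeff_odd_eq_zero (s : ℂ) (m : ℕ) (S : Finset ℕ) :
    ∑ k ∈ S, (bCoeff (2 * m + 1) k : ℂ) / ((2 * m + 1 + k).factorial : ℂ) *
      (descPochhammer ℂ k).eval s = 0 := by
  refine Finset.sum_eq_zero fun k _ => ?_
  have h := congrArg (fun q : ℚ => (q : ℂ)) (bCoeff_odd m k)
  push_cast at h
  rw [h, zero_mul]

theorem hasSum_even_expansion {s : ℂ} (hs : 0 < s.re) :
    HasSum (fun i : ℕ => 1 / (s + 2 * ((i + 1 : ℕ) : ℂ) + 1) *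
        ∑ k ∈ Finset.Icc 1 (i + 1),
          (bCoeff (2 * (i + 1)) k : ℂ) / ((2 * (i + 1) + k).factorial : ℂ) *
            (descPochhammer ℂ k).eval s)
      ((∫ t in Set.Ioo (0 : ℝ) 1, artanhCpow s t) - 1 / (s + 1)) := by
  simp only [sum_bCoeff_eq_artanhQuotCpowCoeff]
  have h := (hasSum_nat_add_iff' 1).2 (hasSum_integral_artanhCpow hs)
  simpa [artanhQuotCpowCoeff_zero] using h

theorem hasSum_expansion {s : ℂ} (hs : 0 < s.re) :
    HasSum (fun i : ℕ => 1 / (s + ((i + 1 : ℕ) : ℂ) + 1) *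
        ∑ k ∈ Finset.Icc 1 ((i + 1) / 2),
          (bCoeff (i + 1) k : ℂ) / ((i + 1 + k).factorial : ℂ) * (descPochhammer ℂ k).eval s)
      ((∫ t in Set.Ioo (0 : ℝ) 1, artanhCpow s t) - 1 / (s + 1)) := by
  -- With `m = i + 1`, the indices `i = 2j + 1` are exactly the even `m = 2(j + 1)`; all other terms
  -- vanish by parity.
  refine (Function.Injective.hasSum_iff (g := fun j : ℕ => 2 * j + 1)
    (fun a b h => by simpa using h) fun i hi => ?_).1 ?_
  · rcases Nat.even_or_odd' i with ⟨j, rfl | rfl⟩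
    · rw [sum_bCoeff_odd_eq_zero, mul_zero]
    · exact absurd ⟨j, rfl⟩ hi
  · refine Eq.mpr (congrArg (fun u => HasSum u _) (funext fun j => ?_)) (hasSum_even_expansion hs)
    simp only [Function.comp_apply]
    rw [show 2 * j + 1 + 1 = 2 * (j + 1) by ring, Nat.mul_div_cancel_left _ two_pos]
    push_cast
    rfl

theorem mainTheorem2 (s : ℂ) (hs : 0 < s.re) :
    -- the left-hand side is continuous at `s` (this matters only for `s = 1`)
    ContinuousAt zetaGammaProduct s ∧
    -- the expansion, first over all `m ≥ 1`, then over even indices `2m` only (index `m = i + 1`)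
    (Summable (fun i : ℕ => 1 / (s + ((i + 1 : ℕ) : ℂ) + 1) *
        ∑ k ∈ Finset.Icc 1 ((i + 1) / 2),
          (bCoeff (i + 1) k : ℂ) / ((i + 1 + k).factorial : ℂ) * (descPochhammer ℂ k).eval s) ∧
      zetaGammaProduct s = 2 ^ (s - 1) / s * (1 / (s + 1) +
        ∑' i : ℕ, 1 / (s + ((i + 1 : ℕ) : ℂ) + 1) *
          ∑ k ∈ Finset.Icc 1 ((i + 1) / 2),
            (bCoeff (i + 1) k : ℂ) / ((i + 1 + k).factorial : ℂ) *
              (descPochhammer ℂ k).eval s)) ∧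
    (Summable (fun i : ℕ => 1 / (s + 2 * ((i + 1 : ℕ) : ℂ) + 1) *
        ∑ k ∈ Finset.Icc 1 (i + 1),
          (bCoeff (2 * (i + 1)) k : ℂ) / ((2 * (i + 1) + k).factorial : ℂ) *
            (descPochhammer ℂ k).eval s) ∧
      zetaGammaProduct s = 2 ^ (s - 1) / s * (1 / (s + 1) +
        ∑' i : ℕ, 1 / (s + 2 * ((i + 1 : ℕ) : ℂ) + 1) *
          ∑ k ∈ Finset.Icc 1 (i + 1),
            (bCoeff (2 * (i + 1)) k : ℂ) / ((2 * (i + 1) + k).factorial : ℂ) *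
              (descPochhammer ℂ k).eval s)) ∧
    -- the same expansion through the `z_{m,k}`, and their recurrence
    zetaGammaProduct s = 2 ^ (s - 1) / s * (1 / (s + 1) +
        ∑' i : ℕ, 1 / (s + 2 * ((i + 1 : ℕ) : ℂ) + 1) *
          ∑ k ∈ Finset.Icc 1 (i + 1), zCoeff s (2 * (i + 1)) k) ∧
    ∀ m k : ℕ, 2 ≤ m → 1 ≤ k →
      zCoeff s m k =
        ((m : ℂ) + k - 2) / (m + k) * zCoeff s (m - 2) k +
          (s - k + 1) / (m + k) * zCoeff s (m - 2) (k - 1) := by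
  have hI := zetaGammaProduct_eq_integral hs
  have h1 := hasSum_expansion hs
  have h2 := hasSum_even_expansion hs
  have e2 : zetaGammaProduct s = 2 ^ (s - 1) / s * (1 / (s + 1) +
      ∑' i : ℕ, 1 / (s + 2 * ((i + 1 : ℕ) : ℂ) + 1) *
        ∑ k ∈ Finset.Icc 1 (i + 1),
          (bCoeff (2 * (i + 1)) k : ℂ) / ((2 * (i + 1) + k).factorial : ℂ) *
            (descPochhammer ℂ k).eval s) := by
    rw [h2.tsum_eq, add_sub_cancel, hI]
  refine ⟨continuousAt_zetaGammaProduct hs, ⟨h1.summable, ?_⟩, ⟨h2.summable, e2⟩, e2,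
    fun m k => zCoeff_recurrence s m k⟩
  rw [h1.tsum_eq, add_sub_cancel, hI]
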